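/- A path in an edge-colored graph is \emph{conflict-free} if some color is used on exactly one of its edges. A connected graph $G$ with an edge-coloring $c$ is \emph{strongly conflict-free connected} under $c$ if any two distinct vertices $u,v$ are joined by a conflict-free path whose length is the distance $d_G(u,v)$. \textbf{Theorem.} There is a polynomial-time algorithm that, given an integer $k\ge 1$ and a finite connected simple graph $G$ with $n$ vertices and $m$ edges together with an edge-coloring $c\colon E(G)\to\{1,\dots,k\}$, decides whether $G$ is strongly conflict-free connected under $c$. Its running time is $O(n^2m^2)$ (and $O(1)$ for the one-vertex graph, where $m=0$). Precisely, the algorithm is a single program of a unit-cost random access machine (assignment, addition and subtraction of $1$, indirect addressing of arrays, comparison of two registers, branching and loops, where each elementary instruction and each test counts as one step). Its input consists of $n$, $m$, $k$ and an arbitrary list of the edges, with the numbers of their two ends, in either order, and their colors, for any numbering of the vertices by $0,\dots,n-1$. There is a constant $C$, independent of $n,m,k,G,c$ and of the list, such that on every such input the program halts after at most $C\,(n^2m^2+1)$ steps with the correct answer. -/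

import Mathlib

/-! ### Conflict-free paths -/

/-- A walk in an edge-coloured graph is conflict-free if some colour is used on exactly one
of its edges. -/
def SimpleGraph.Walk.ConflictFree {V : Type*} {G : SimpleGraph V} {κ : Type*}
    (c : G.edgeSet → κ) {u v : V} (p : G.Walk u v) : Prop :=
  ∃ i : κ, ∃! e : G.edgeSet, (e : Sym2 V) ∈ p.edges ∧ c e = i

/-- Any two distinct vertices are joined by a conflict-free path that is a shortest path. -/
def SimpleGraph.StronglyConflictFreeConnected {V : Type*} (G : SimpleGraph V) {κ : Type*}
    (c : G.edgeSet → κ) : Prop :=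
  ∀ u v : V, u ≠ v →
    ∃ p : G.Walk u v, p.IsPath ∧ p.length = G.dist u v ∧ p.ConflictFree c

/-! ### A unit-cost random access machine

Programs are finite while-programs over a random access memory. There are registers
`0, 1, 2, …` and arrays `0, 1, 2, …`, of which a program mentions only finitely many; registers
and array cells hold natural numbers, and an array cell is addressed by the content of a register.
The only arithmetic is `± 1`. So after `t` steps no cell exceeds the largest of the input
numbers and the constants of the program by more than `t`, and unit cost hides no
arithmetic on long numbers. -/

namespace RAM

/-- The content of the registers and of the arrays. -/
structure State where
  reg : ℕ → ℕ
  mem : ℕ → ℕ → ℕ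

/-- Assign the value `a` to the register `x`. -/
def State.setReg (σ : State) (x a : ℕ) : State :=
  { σ with reg := Function.update σ.reg x a }

/-- Assign the value `a` to the cell `i` of the array `A`. -/
def State.setMem (σ : State) (A i a : ℕ) : State :=
  { σ with mem := Function.update σ.mem A (Function.update (σ.mem A) i a) }

/-- Elementary tests on two registers. -/
inductive Test where
  /-- register `x` equals register `y` -/
  | eq (x y : ℕ)
  /-- register `x` is less than register `y` -/
  | lt (x y : ℕ)

/-- The truth of a test in a state. -/
def Test.Holds : Test → State → Prop
  | .eq x y, σ => σ.reg x = σ.reg y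
  | .lt x y, σ => σ.reg x < σ.reg y

/-- Elementary instructions. -/
inductive Instr where
  /-- `x := a` for a constant `a` -/
  | const (x a : ℕ)
  /-- `x := y` -/
  | copy (x y : ℕ)
  /-- `x := y + 1` -/
  | succ (x y : ℕ)
  /-- `x := y - 1`, where `0 - 1 = 0` -/
  | pred (x y : ℕ)
  /-- `x := A[y]` -/
  | load (x A y : ℕ)
  /-- `A[x] := y` -/
  | store (A x y : ℕ)

/-- The effect of an elementary instruction. -/
def Instr.apply : Instr → State → State
  | .const x a, σ => σ.setReg x a
  | .copy x y, σ => σ.setReg x (σ.reg y)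
  | .succ x y, σ => σ.setReg x (σ.reg y + 1)
  | .pred x y, σ => σ.setReg x (σ.reg y - 1)
  | .load x A y, σ => σ.setReg x (σ.mem A (σ.reg y))
  | .store A x y, σ => σ.setMem A (σ.reg x) (σ.reg y)

/-- Programs; `loop b P` is the loop `while b do P`. -/
inductive Program where
  | skip
  | instr (I : Instr)
  | seq (P Q : Program)
  | ite (b : Test) (P Q : Program)
  | loop (b : Test) (P : Program)

/-- `Exec P σ σ' t`: started in the state `σ`, the program `P` halts in the state `σ'` after
`t` steps. Every execution of an elementary instruction (or of `skip`) and every evaluation of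
a test is one step. -/
inductive Exec : Program → State → State → ℕ → Prop
  | skip (σ : State) : Exec .skip σ σ 1
  | instr (I : Instr) (σ : State) : Exec (.instr I) σ (I.apply σ) 1
  | seq {P Q : Program} {σ₁ σ₂ σ₃ : State} {s t : ℕ}
      (hP : Exec P σ₁ σ₂ s) (hQ : Exec Q σ₂ σ₃ t) : Exec (.seq P Q) σ₁ σ₃ (s + t)
  | ite_true {b : Test} {P Q : Program} {σ σ' : State} {t : ℕ}
      (hb : b.Holds σ) (h : Exec P σ σ' t) : Exec (.ite b P Q) σ σ' (t + 1)
  | ite_false {b : Test} {P Q : Program} {σ σ' : State} {t : ℕ}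
      (hb : ¬ b.Holds σ) (h : Exec Q σ σ' t) : Exec (.ite b P Q) σ σ' (t + 1)
  | loop_false {b : Test} {P : Program} {σ : State}
      (hb : ¬ b.Holds σ) : Exec (.loop b P) σ σ 1
  | loop_true {b : Test} {P : Program} {σ₁ σ₂ σ₃ : State} {s t : ℕ}
      (hb : b.Holds σ₁) (hP : Exec P σ₁ σ₂ s) (hW : Exec (.loop b P) σ₂ σ₃ t) :
      Exec (.loop b P) σ₁ σ₃ (s + t + 1)

/-- A program has at most one final state and one number of steps. -/
theorem Exec.deterministic {P : Program} {σ σ₁ σ₂ : State} {t₁ t₂ : ℕ}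
    (h₁ : Exec P σ σ₁ t₁) (h₂ : Exec P σ σ₂ t₂) : σ₁ = σ₂ ∧ t₁ = t₂ := by
  induction h₁ generalizing σ₂ t₂ with
  | skip => cases h₂; exact ⟨rfl, rfl⟩
  | instr => cases h₂; exact ⟨rfl, rfl⟩
  | seq _ _ ihP ihQ =>
    cases h₂ with
    | seq hP hQ =>
      obtain ⟨rfl, rfl⟩ := ihP hP
      obtain ⟨rfl, rfl⟩ := ihQ hQ
      exact ⟨rfl, rfl⟩
  | ite_true hb _ ih =>
    cases h₂ with
    | ite_true _ h => obtain ⟨rfl, rfl⟩ := ih h; exact ⟨rfl, rfl⟩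
    | ite_false hb' _ => exact absurd hb hb'
  | ite_false hb _ ih =>
    cases h₂ with
    | ite_true hb' _ => exact absurd hb' hb
    | ite_false _ h => obtain ⟨rfl, rfl⟩ := ih h; exact ⟨rfl, rfl⟩
  | loop_false hb =>
    cases h₂ with
    | loop_false _ => exact ⟨rfl, rfl⟩
    | loop_true hb' _ _ => exact absurd hb' hb
  | loop_true hb _ _ ihP ihW =>
    cases h₂ with
    | loop_false hb' => exact absurd hb hb'
    | loop_true _ hP hW =>
      obtain ⟨rfl, rfl⟩ := ihP hP
      obtain ⟨rfl, rfl⟩ := ihW hW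
      exact ⟨rfl, rfl⟩

end RAM

/-! ### Edge-coloured graphs as inputs -/

/-- A presentation of a finite graph by a list of its edges: a numbering of the `n` vertices by
`0, …, n - 1`, a numbering of the `m` edges by `0, …, m - 1`, and the two ends of every edge,
in some order. -/
structure EdgeList {V : Type*} (G : SimpleGraph V) where
  vert : V ≃ Fin (Nat.card V)
  edge : Fin (Nat.card G.edgeSet) ≃ G.edgeSet
  fst : Fin (Nat.card G.edgeSet) → V
  snd : Fin (Nat.card G.edgeSet) → V
  edge_eq : ∀ j, (edge j : Sym2 V) = s(fst j, snd j)

/-- The initial state of a machine whose input is the graph `G` with the edge-colouring `c`: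
registers `0, 1, 2` hold `n`, `m` and `k`; cell `j` of the arrays `0, 1, 2` holds the first end,
the second end and the colour (a number in `{1, …, k}`) of the edge `j`. All else is zero. -/
noncomputable def EdgeList.initialState {V : Type*} {G : SimpleGraph V} (L : EdgeList G) {k : ℕ}
    (c : G.edgeSet → Fin k) : RAM.State where
  reg
    | 0 => Nat.card V
    | 1 => Nat.card G.edgeSet
    | 2 => k
    | _ => 0
  mem A j :=
    if h : j < Nat.card G.edgeSet then
      match A with
      | 0 => L.vert (L.fst ⟨j, h⟩)
      | 1 => L.vert (L.snd ⟨j, h⟩)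
      | 2 => (c (L.edge ⟨j, h⟩) : ℕ) + 1
      | _ => 0
    else 0

/-!
For a fixed vertex `u` and a fixed colour `i`, one breadth-first search from `u` finds every vertex
`w` with a shortest path to `u` on which the colour `i` occurs exactly once. A tail of a shortest
path is a shortest path, so a shortest path from a vertex `b` at distance `d + 1` is an edge `ba`
to a vertex `a` at distance `d`, followed by a shortest path from `a`. If `ba` has the colour `i`,
then `i` must not occur on the rest; if not, then `i` occurs on the rest exactly once. In the same
way, the paths that avoid `i` are extended. Hence it suffices to keep, for each vertex, its
distance and two bits, and to compute them level by level (`SimpleGraph.SearchInv.use`,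
`SimpleGraph.SearchInv.next`). A colour that occurs on a path is the colour of some edge, so only
the `m` colours in the list of edges need to be tried, whatever `k` is. The graph is strongly
conflict-free connected if and only if for every `u`, every `w ≠ u` is found for some colour
(`SimpleGraph.stronglyConflictFreeConnected_iff`).

No queue is needed for the search within the time allowed: each of `n` levels is computed by running
through all `m` edges, in both directions, which takes time `O(nm)`. With `n` vertices `u` and
`m` colours this is `O(n²m²)`. All other terms are smaller, because a connected graph with more
than one vertex has an edge (`RAM.runningTime_le`).

The program is verified with a Hoare logic for total correctness with time bounds, `RAM.Runs`,
whose rule for counting loops `RAM.Runs.forLoop` carries an invariant. A syntactic frame property,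
`RAM.Frame.of_exec`, tells that a program changes only the registers and arrays it mentions as
targets, so that invariants speak only of what does change.
-/

/-! ### Runs with a time bound -/

namespace RAM

/-- Total correctness with a time bound: started in `σ`, the program `P` halts after at most `T`
steps in a state that satisfies `Q`. -/
def Runs (P : Program) (σ : State) (T : ℕ) (Q : State → Prop) : Prop :=
  ∃ σ' t, Exec P σ σ' t ∧ t ≤ T ∧ Q σ'

theorem Runs.mono {P : Program} {σ : State} {S T : ℕ} {Q R : State → Prop}
    (h : Runs P σ S Q) (hT : S ≤ T) (hQ : ∀ τ, Q τ → R τ) : Runs P σ T R := by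
  obtain ⟨τ, t, he, ht, hq⟩ := h
  exact ⟨τ, t, he, ht.trans hT, hQ τ hq⟩

theorem Runs.skip {σ : State} {T : ℕ} {Q : State → Prop} (h : Q σ) :
    Runs .skip σ (T + 1) Q :=
  ⟨σ, 1, .skip σ, by omega, h⟩

theorem Runs.instr {I : Instr} {σ : State} {T : ℕ} {Q : State → Prop} (h : Q (I.apply σ)) :
    Runs (.instr I) σ (T + 1) Q :=
  ⟨_, 1, .instr I σ, by omega, h⟩

theorem Runs.seq {P P' : Program} {σ : State} {S T : ℕ} {Q R : State → Prop}
    (h : Runs P σ S Q) (h' : ∀ τ, Q τ → Runs P' τ T R) : Runs (.seq P P') σ (S + T) R := by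
  obtain ⟨τ, s, he, hs, hq⟩ := h
  obtain ⟨τ', t, he', ht, hr⟩ := h' τ hq
  exact ⟨τ', s + t, .seq he he', by omega, hr⟩

theorem Runs.instr_seq {I : Instr} {P : Program} {σ : State} {T : ℕ} {R : State → Prop}
    (h : Runs P (I.apply σ) T R) : Runs (.seq (.instr I) P) σ (T + 1) R := by
  obtain ⟨τ, t, he, ht, hr⟩ := h
  exact ⟨τ, 1 + t, .seq (.instr I σ) he, by omega, hr⟩

theorem Runs.ite {b : Test} {P P' : Program} {σ : State} {T : ℕ} {R : State → Prop}
    (h : b.Holds σ → Runs P σ T R) (h' : ¬ b.Holds σ → Runs P' σ T R) :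
    Runs (.ite b P P') σ (T + 1) R := by
  by_cases hb : b.Holds σ
  · obtain ⟨τ, t, he, ht, hr⟩ := h hb
    exact ⟨τ, t + 1, .ite_true hb he, by omega, hr⟩
  · obtain ⟨τ, t, he, ht, hr⟩ := h' hb
    exact ⟨τ, t + 1, .ite_false hb he, by omega, hr⟩

theorem Runs.skip_seq {P : Program} {σ : State} {T : ℕ} {R : State → Prop}
    (h : Runs P σ T R) : Runs (.seq .skip P) σ (T + 1) R := by
  obtain ⟨τ, t, he, ht, hr⟩ := h
  exact ⟨τ, 1 + t, .seq (.skip σ) he, by omega, hr⟩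

theorem Runs.ite_seq {b : Test} {P P' Q : Program} {σ : State} {T : ℕ} {R : State → Prop}
    (h : b.Holds σ → Runs (.seq P Q) σ T R) (h' : ¬ b.Holds σ → Runs (.seq P' Q) σ T R) :
    Runs (.seq (.ite b P P') Q) σ (T + 1) R := by
  by_cases hb : b.Holds σ
  · obtain ⟨τ, t, he, ht, hr⟩ := h hb
    cases he with
    | seq h1 h2 => exact ⟨τ, _, .seq (.ite_true hb h1) h2, by omega, hr⟩
  · obtain ⟨τ, t, he, ht, hr⟩ := h' hb
    cases he with
    | seq h1 h2 => exact ⟨τ, _, .seq (.ite_false hb h1) h2, by omega, hr⟩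

@[simp] theorem State.setReg_reg (σ : State) (x a y : ℕ) :
    (σ.setReg x a).reg y = if y = x then a else σ.reg y := by
  simp [State.setReg, Function.update_apply]

@[simp] theorem State.setReg_mem (σ : State) (x a : ℕ) : (σ.setReg x a).mem = σ.mem := rfl

@[simp] theorem State.setMem_reg (σ : State) (A i a : ℕ) : (σ.setMem A i a).reg = σ.reg := rfl

@[simp] theorem State.setMem_mem (σ : State) (A i a B j : ℕ) :
    (σ.setMem A i a).mem B j = if B = A ∧ j = i then a else σ.mem B j := by
  by_cases h : B = A
  · subst h
    simp [State.setMem, Function.update_apply]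
  · simp [State.setMem, h]

/-! ### What a program leaves alone -/

/-- The registers that occur as the target of an instruction of the program. -/
def Program.regs : Program → List ℕ
  | .skip => []
  | .instr (.const x _) => [x]
  | .instr (.copy x _) => [x]
  | .instr (.succ x _) => [x]
  | .instr (.pred x _) => [x]
  | .instr (.load x _ _) => [x]
  | .instr (.store _ _ _) => []
  | .seq P Q => P.regs ++ Q.regs
  | .ite _ P Q => P.regs ++ Q.regs
  | .loop _ P => P.regs

/-- The arrays that occur as the target of an instruction of the program. -/
def Program.arrays : Program → List ℕ
  | .instr (.store A _ _) => [A]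
  | .seq P Q => P.arrays ++ Q.arrays
  | .ite _ P Q => P.arrays ++ Q.arrays
  | .loop _ P => P.arrays
  | _ => []

/-- The states `σ` and `τ` agree outside the registers and arrays that `P` may change. -/
def Frame (P : Program) (σ τ : State) : Prop :=
  (∀ x ∉ P.regs, τ.reg x = σ.reg x) ∧ ∀ A ∉ P.arrays, τ.mem A = σ.mem A

theorem Frame.mono {P Q : Program} {σ τ : State} (h : Frame P σ τ)
    (hr : P.regs ⊆ Q.regs) (ha : P.arrays ⊆ Q.arrays) : Frame Q σ τ :=
  ⟨fun x hx => h.1 x fun h' => hx (hr h'), fun A hA => h.2 A fun h' => hA (ha h')⟩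

theorem Frame.refl (P : Program) (σ : State) : Frame P σ σ :=
  ⟨fun _ _ => rfl, fun _ _ => rfl⟩

theorem Frame.trans {P : Program} {σ τ υ : State} (h : Frame P σ τ) (h' : Frame P τ υ) :
    Frame P σ υ :=
  ⟨fun x hx => (h'.1 x hx).trans (h.1 x hx), fun A hA => (h'.2 A hA).trans (h.2 A hA)⟩

theorem Frame.of_exec {P : Program} {σ τ : State} {t : ℕ} (h : Exec P σ τ t) : Frame P σ τ := by
  induction h with
  | skip => exact Frame.refl _ _
  | instr I σ =>
    cases I with
    | store A x y =>
      refine ⟨fun z _ => rfl, fun B hB => ?_⟩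
      have hB' : B ≠ A := by simpa [Program.arrays] using hB
      simp [Instr.apply, State.setMem, hB']
    | _ =>
      refine ⟨fun z hz => ?_, fun B _ => rfl⟩
      simp only [Program.regs, List.mem_singleton] at hz
      simp [Instr.apply, hz]
  | seq _ _ ihP ihQ =>
    exact (ihP.mono (by simp [Program.regs]) (by simp [Program.arrays])).trans
      (ihQ.mono (by simp [Program.regs]) (by simp [Program.arrays]))
  | ite_true _ _ ih => exact ih.mono (by simp [Program.regs]) (by simp [Program.arrays])
  | ite_false _ _ ih => exact ih.mono (by simp [Program.regs]) (by simp [Program.arrays])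
  | loop_false => exact Frame.refl _ _
  | loop_true _ _ _ ihP ihW =>
    exact (ihP.mono (by simp [Program.regs]) (by simp [Program.arrays])).trans ihW

theorem Runs.frame {P : Program} {σ : State} {T : ℕ} {Q : State → Prop} (h : Runs P σ T Q) :
    Runs P σ T fun τ => Frame P σ τ ∧ Q τ := by
  obtain ⟨τ, t, he, ht, hq⟩ := h
  exact ⟨τ, t, he, ht, .of_exec he, hq⟩

/-! ### Counting loops -/

/-- `for x := 0, …, y - 1 do P`, with registers `x` and `y`. -/
def Program.forLoop (x y : ℕ) (P : Program) : Program :=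
  .seq (.instr (.const x 0)) (.loop (.lt x y) (.seq P (.instr (.succ x x))))

/-- The invariant rule for counting loops: `I i` holds when the loop body has been run `i` times.
What the loop does not write may be recovered from the initial state. -/
theorem Runs.forLoop {x y : ℕ} {P : Program} {σ : State} {N T : ℕ} (I : ℕ → State → Prop)
    (hN : σ.reg y = N) (hx : x ∉ P.regs) (hy : y ∉ (Program.forLoop x y P).regs)
    (zero : I 0 (σ.setReg x 0))
    (step : ∀ i < N, ∀ τ, Frame (.forLoop x y P) σ τ → τ.reg x = i → I i τ →
      Runs P τ T fun υ => I (i + 1) (υ.setReg x (i + 1))) :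
    Runs (.forLoop x y P) σ (N * (T + 2) + 2) fun τ => Frame (.forLoop x y P) σ τ ∧ I N τ := by
  have key : ∀ r i, i + r = N → ∀ τ, Frame (.forLoop x y P) σ τ → τ.reg x = i → I i τ →
      Runs (.loop (.lt x y) (.seq P (.instr (.succ x x)))) τ (r * (T + 2) + 1) (I N) := by
    intro r
    induction r with
    | zero =>
      intro i hi τ hf hxi hI
      refine ⟨τ, 1, .loop_false ?_, by omega, ?_⟩
      · simp only [Test.Holds, hf.1 y hy, hN, hxi]
        omega
      · rwa [← show i = N from hi]
    | succ r ih =>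
      intro i hi τ hf hxi hI
      obtain ⟨υ, s, he, hs, hI'⟩ := step i (by omega) τ hf hxi hI
      have hυ : υ.reg x = i := ((Frame.of_exec he).1 x hx).trans hxi
      have hQ : Exec (.seq P (.instr (.succ x x))) τ (υ.setReg x (i + 1)) (s + 1) := by
        have := Exec.instr (.succ x x) υ
        rw [Instr.apply, hυ] at this
        exact .seq he this
      obtain ⟨ρ, t, he', ht, hq⟩ := ih (i + 1) (by omega) (υ.setReg x (i + 1))
        (hf.trans ((Frame.of_exec hQ).mono (by simp [Program.forLoop, Program.regs])
          (by simp [Program.forLoop, Program.arrays]))) (by simp) hI'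
      refine ⟨ρ, s + 1 + t + 1, .loop_true ?_ hQ he', ?_, hq⟩
      · simp only [Test.Holds, hf.1 y hy, hN, hxi]
        omega
      · rw [Nat.succ_mul]
        omega
  refine Runs.frame ((Runs.instr_seq (T := N * (T + 2) + 1) ?_).mono le_rfl fun _ h => h)
  refine key N 0 (by omega) _ ⟨fun z hz => ?_, fun _ _ => rfl⟩ (by simp [Instr.apply]) zero
  have hz' : z ≠ x := by
    rintro rfl
    simp [Program.forLoop, Program.regs] at hz
  simp [Instr.apply, hz']

end RAM

/-! ### Shortest paths with no or one edge of a given colour -/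

namespace SimpleGraph

variable {V : Type*} {G : SimpleGraph V} {κ : Type*}

/-- Some shortest path from `w` to `u` has no edge of colour `i`. -/
def HasAvoidingGeodesic (c : G.edgeSet → κ) (i : κ) (u w : V) : Prop :=
  ∃ p : G.Walk w u, p.length = G.dist w u ∧ ∀ e : G.edgeSet, (e : Sym2 V) ∈ p.edges → c e ≠ i

/-- Some shortest path from `w` to `u` has exactly one edge of colour `i`. -/
def HasOnceGeodesic (c : G.edgeSet → κ) (i : κ) (u w : V) : Prop :=
  ∃ p : G.Walk w u, p.length = G.dist w u ∧
    ∃! e : G.edgeSet, (e : Sym2 V) ∈ p.edges ∧ c e = i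

theorem stronglyConflictFreeConnected_iff (c : G.edgeSet → κ) :
    G.StronglyConflictFreeConnected c ↔
      ∀ u w : V, w = u ∨ ∃ i, HasOnceGeodesic c i u w := by
  constructor
  · intro h u w
    by_cases huw : w = u
    · exact .inl huw
    · obtain ⟨p, -, hl, i, hi⟩ := h w u huw
      exact .inr ⟨i, p, hl, hi⟩
  · intro h u w huw
    obtain rfl | ⟨i, p, hl, hi⟩ := h w u
    · exact absurd rfl huw
    · exact ⟨p, p.isPath_of_length_eq_dist hl, hl, i, hi⟩

theorem HasAvoidingGeodesic.refl (c : G.edgeSet → κ) (i : κ) (u : V) :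
    HasAvoidingGeodesic c i u u :=
  ⟨.nil, by simp, by simp⟩

theorem HasOnceGeodesic.ne {c : G.edgeSet → κ} {i : κ} {u w : V}
    (h : HasOnceGeodesic c i u w) : w ≠ u := by
  rintro rfl
  obtain ⟨p, hl, e, ⟨he, -⟩, -⟩ := h
  rw [dist_self] at hl
  cases p with
  | nil => simp at he
  | cons => simp at hl

theorem HasOnceGeodesic.exists_color_eq {c : G.edgeSet → κ} {i : κ} {u w : V}
    (h : HasOnceGeodesic c i u w) : ∃ e, c e = i := by
  obtain ⟨p, -, e, ⟨-, he⟩, -⟩ := h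
  exact ⟨e, he⟩

theorem HasAvoidingGeodesic.cons {c : G.edgeSet → κ} {i : κ} {u a b : V} (h : G.Adj b a)
    (hd : G.dist b u = G.dist a u + 1) (hc : c ⟨s(b, a), h⟩ ≠ i)
    (ha : HasAvoidingGeodesic c i u a) : HasAvoidingGeodesic c i u b := by
  obtain ⟨p, hl, hp⟩ := ha
  refine ⟨.cons h p, by simp [hl, hd], ?_⟩
  rintro ⟨e, he⟩ hmem
  simp only [Walk.edges_cons, List.mem_cons] at hmem
  rcases hmem with rfl | hmem
  · exact hc
  · exact hp _ hmem

theorem HasAvoidingGeodesic.cons_once {c : G.edgeSet → κ} {i : κ} {u a b : V} (h : G.Adj b a)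
    (hd : G.dist b u = G.dist a u + 1) (hc : c ⟨s(b, a), h⟩ = i)
    (ha : HasAvoidingGeodesic c i u a) : HasOnceGeodesic c i u b := by
  obtain ⟨p, hl, hp⟩ := ha
  refine ⟨.cons h p, by simp [hl, hd], ⟨s(b, a), h⟩, ⟨by simp, hc⟩, ?_⟩
  rintro ⟨e, he⟩ ⟨hmem, hce⟩
  simp only [Walk.edges_cons, List.mem_cons] at hmem
  rcases hmem with rfl | hmem
  · rfl
  · exact absurd hce (hp _ hmem)

theorem HasOnceGeodesic.cons {c : G.edgeSet → κ} {i : κ} {u a b : V} (h : G.Adj b a)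
    (hd : G.dist b u = G.dist a u + 1) (hc : c ⟨s(b, a), h⟩ ≠ i)
    (ha : HasOnceGeodesic c i u a) : HasOnceGeodesic c i u b := by
  obtain ⟨p, hl, f, ⟨hf, hfc⟩, hp⟩ := ha
  refine ⟨.cons h p, by simp [hl, hd], f, ⟨by simp [hf], hfc⟩, ?_⟩
  rintro ⟨e, he⟩ ⟨hmem, hce⟩
  simp only [Walk.edges_cons, List.mem_cons] at hmem
  rcases hmem with rfl | hmem
  · exact absurd hce hc
  · exact hp _ ⟨hmem, hce⟩

/-- A tail of a shortest path is a shortest path. -/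
theorem dist_eq_add_one_of_cons {u a b : V} (h : G.Adj b a) (p : G.Walk a u)
    (hl : (Walk.cons h p).length = G.dist b u) :
    p.length = G.dist a u ∧ G.dist b u = G.dist a u + 1 := by
  obtain ⟨q, hq⟩ := (Walk.reachable p).exists_walk_length_eq_dist
  have h1 := dist_le p
  have h2 := dist_le (Walk.cons h q)
  simp only [Walk.length_cons] at hl h2
  omega

theorem HasAvoidingGeodesic.exists_adj {c : G.edgeSet → κ} {i : κ} {u b : V}
    (hb : HasAvoidingGeodesic c i u b) (hpos : G.dist b u ≠ 0) :
    ∃ (a : V) (h : G.Adj b a), G.dist b u = G.dist a u + 1 ∧ c ⟨s(b, a), h⟩ ≠ i ∧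
      HasAvoidingGeodesic c i u a := by
  obtain ⟨p, hl, hp⟩ := hb
  cases p with
  | nil => simp at hpos
  | @cons _ a _ h p =>
    obtain ⟨hl', hd⟩ := dist_eq_add_one_of_cons h p hl
    exact ⟨a, h, hd, hp _ (by simp), p, hl', fun e he => hp e (by simp [he])⟩

theorem HasOnceGeodesic.exists_adj {c : G.edgeSet → κ} {i : κ} {u b : V}
    (hb : HasOnceGeodesic c i u b) :
    ∃ (a : V) (h : G.Adj b a), G.dist b u = G.dist a u + 1 ∧
      (c ⟨s(b, a), h⟩ = i ∧ HasAvoidingGeodesic c i u a ∨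
        c ⟨s(b, a), h⟩ ≠ i ∧ HasOnceGeodesic c i u a) := by
  obtain ⟨p, hl, f, ⟨hf, hfc⟩, hp⟩ := hb
  cases p with
  | nil => simp at hf
  | @cons _ a _ h p =>
    obtain ⟨hl', hd⟩ := dist_eq_add_one_of_cons h p hl
    refine ⟨a, h, hd, ?_⟩
    have hnd := ((Walk.cons h p).isPath_of_length_eq_dist hl).isTrail.edges_nodup
    simp only [Walk.edges_cons, List.nodup_cons] at hnd
    by_cases hc : c ⟨s(b, a), h⟩ = i
    · refine .inl ⟨hc, p, hl', fun e he hce => hnd.1 ?_⟩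
      have h1 := hp e ⟨by simp [he], hce⟩
      have h2 := hp ⟨s(b, a), h⟩ ⟨by simp, hc⟩
      rwa [h1.trans h2.symm] at he
    · refine .inr ⟨hc, p, hl', f, ⟨?_, hfc⟩, fun e ⟨he, hce⟩ => hp e ⟨by simp [he], hce⟩⟩
      simp only [Walk.edges_cons, List.mem_cons] at hf
      rcases hf with hf | hf
      · exact absurd (by rw [← hfc]; congr 1; exact Subtype.ext hf.symm) hc
      · exact hf

theorem Connected.exists_adj_dist_eq_add_one (hG : G.Connected) {u b : V}
    (hpos : G.dist b u ≠ 0) : ∃ a, G.Adj b a ∧ G.dist b u = G.dist a u + 1 := by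
  obtain ⟨p, hl⟩ := hG.exists_walk_length_eq_dist b u
  cases p with
  | nil => simp at hpos
  | @cons _ a _ h p => exact ⟨a, h, (dist_eq_add_one_of_cons h p hl).2⟩

theorem Connected.dist_lt_natCard [Finite V] (hG : G.Connected) (u w : V) :
    G.dist w u < Nat.card V := by
  have := Fintype.ofFinite V
  obtain ⟨p, hp, hl⟩ := hG.exists_path_of_dist w u
  rw [← hl, Nat.card_eq_fintype_card]
  exact hp.length_lt

/-! ### The search for shortest paths -/

/-- The invariant of a breadth-first search from `u` that records distances `D` (the number `n` of
vertices where no distance has been found) and sets `A`, `O` of vertices with a shortest path to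
`u` on which the colour `i` occurs never, or exactly once. The record is correct, it is complete
for the vertices at distance at most `d`, and every pair `(a, b) ∈ E` of adjacent vertices at
distances `d` and `d + 1` has been used to extend shortest paths from `a` to `b`. -/
structure SearchInv (c : G.edgeSet → κ) (i : κ) (u : V) (d : ℕ) (E : Set (V × V))
    (D : V → ℕ) (A O : Set V) : Prop where
  dist_or : ∀ w, D w = G.dist w u ∨ D w = Nat.card V
  dist_eq : ∀ w, G.dist w u ≤ d → D w = G.dist w u
  of_mem_avoid : ∀ w ∈ A, HasAvoidingGeodesic c i u w
  of_mem_once : ∀ w ∈ O, HasOnceGeodesic c i u w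
  mem_avoid : ∀ w, G.dist w u ≤ d → HasAvoidingGeodesic c i u w → w ∈ A
  mem_once : ∀ w, G.dist w u ≤ d → HasOnceGeodesic c i u w → w ∈ O
  used : ∀ a b (h : G.Adj b a), (a, b) ∈ E → G.dist a u = d → G.dist b u = d + 1 →
    D b = d + 1 ∧ (c ⟨s(b, a), h⟩ ≠ i → HasAvoidingGeodesic c i u a → b ∈ A) ∧
      (c ⟨s(b, a), h⟩ = i → HasAvoidingGeodesic c i u a → b ∈ O) ∧
      (c ⟨s(b, a), h⟩ ≠ i → HasOnceGeodesic c i u a → b ∈ O)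

theorem SearchInv.anti {c : G.edgeSet → κ} {i : κ} {u : V} {d : ℕ} {E E' : Set (V × V)}
    {D : V → ℕ} {A O : Set V} (h : SearchInv c i u d E D A O) (hE : E' ⊆ E) :
    SearchInv c i u d E' D A O :=
  { h with used := fun a b hab hmem => h.used a b hab (hE hmem) }

theorem SearchInv.init (hG : G.Connected) {c : G.edgeSet → κ} {i : κ} {u : V}
    {D : V → ℕ} {A O : Set V} (hu : D u = 0) (hD : ∀ w, w ≠ u → D w = Nat.card V)
    (hA : ∀ w, w ∈ A ↔ w = u) (hO : ∀ w, w ∉ O) :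
    SearchInv c i u 0 ∅ D A O where
  dist_or w := by
    by_cases hw : w = u
    · subst hw
      simp [hu]
    · exact .inr (hD w hw)
  dist_eq w hw := by
    obtain rfl : w = u := hG.dist_eq_zero_iff.1 (by omega)
    simp [hu]
  of_mem_avoid w hw := by
    rw [(hA w).1 hw]
    exact .refl c i u
  of_mem_once w hw := absurd hw (hO w)
  mem_avoid w hw _ := (hA w).2 (hG.dist_eq_zero_iff.1 (by omega))
  mem_once w hw h := absurd (hG.dist_eq_zero_iff.1 (by omega)) h.ne
  used a b h hmem := absurd hmem (Set.notMem_empty _)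

/-- When all pairs of adjacent vertices have been used, the next level is complete. -/
theorem SearchInv.next (hG : G.Connected) {c : G.edgeSet → κ} {i : κ} {u : V} {d : ℕ}
    {E : Set (V × V)} {D : V → ℕ} {A O : Set V} (h : SearchInv c i u d E D A O)
    (hE : ∀ a b, G.Adj b a → (a, b) ∈ E) : SearchInv c i u (d + 1) ∅ D A O where
  dist_or := h.dist_or
  dist_eq b hb := by
    rcases Nat.lt_or_ge d (G.dist b u) with hlt | hle
    · obtain ⟨a, hab, hd⟩ := hG.exists_adj_dist_eq_add_one (u := u) (b := b) (by omega)
      rw [(h.used a b hab (hE a b hab) (by omega) (by omega)).1]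
      omega
    · exact h.dist_eq b hle
  of_mem_avoid := h.of_mem_avoid
  of_mem_once := h.of_mem_once
  mem_avoid b hb hA := by
    rcases Nat.lt_or_ge d (G.dist b u) with hlt | hle
    · obtain ⟨a, hab, hd, hc, ha⟩ := hA.exists_adj (by omega)
      exact (h.used a b hab (hE a b hab) (by omega) (by omega)).2.1 hc ha
    · exact h.mem_avoid b hle hA
  mem_once b hb hO := by
    rcases Nat.lt_or_ge d (G.dist b u) with hlt | hle
    · obtain ⟨a, hab, hd, ⟨hc, ha⟩ | ⟨hc, ha⟩⟩ := hO.exists_adj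
      · exact (h.used a b hab (hE a b hab) (by omega) (by omega)).2.2.1 hc ha
      · exact (h.used a b hab (hE a b hab) (by omega) (by omega)).2.2.2 hc ha
    · exact h.mem_once b hle hO
  used a b hab hmem := absurd hmem (Set.notMem_empty _)

/-- The effect on the record of using the pair `(a, b)`, joined by an edge that has the colour `i`
if and only if `q` holds: if `a` is at distance `d` and no distance up to `d` is known for `b`,
then `b` is at distance `d + 1` and the shortest paths from `a` are extended to `b`. -/
theorem SearchInv.use [Finite V] (hG : G.Connected) {c : G.edgeSet → κ} {i : κ} {u : V} {d : ℕ}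
    {E : Set (V × V)} {D D' : V → ℕ} {A A' O O' : Set V} (h : SearchInv c i u d E D A O)
    {a b : V} (hab : G.Adj b a) {q : Prop} (hq : q ↔ c ⟨s(b, a), hab⟩ = i)
    (hD : ∀ w, (w = b ∧ D a = d ∧ d < D b → D' w = d + 1) ∧
      (¬ (w = b ∧ D a = d ∧ d < D b) → D' w = D w))
    (hA : ∀ w, w ∈ A' ↔ w ∈ A ∨ (w = b ∧ D a = d ∧ d < D b) ∧ ¬ q ∧ a ∈ A)
    (hO : ∀ w, w ∈ O' ↔ w ∈ O ∨
      (w = b ∧ D a = d ∧ d < D b) ∧ (q ∧ a ∈ A ∨ ¬ q ∧ a ∈ O)) :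
    SearchInv c i u d (insert (a, b) E) D' A' O' := by
  have hn := hG.dist_lt_natCard u
  have tri : ∀ a b, G.Adj b a → G.dist b u ≤ G.dist a u + 1 := by
    intro a b hab
    have := hG.dist_triangle (u := b) (v := a) (w := u)
    rw [dist_eq_one_iff_adj.2 hab] at this
    omega
  have key : D a = d → d < D b → G.dist a u = d ∧ G.dist b u = d + 1 := by
    intro h1 h2
    -- no recorded distance exceeds `n`, so `d < n` and the distance recorded at `a` is genuine
    have hdn : d < Nat.card V := by
      have := hn b
      rcases h.dist_or b with h4 | h4 <;> omega
    have ha : G.dist a u = d := by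
      rcases h.dist_or a with h4 | h4 <;> omega
    have := tri a b hab
    have hb : ¬ G.dist b u ≤ d := fun hb => by
      have := h.dist_eq b hb
      omega
    omega
  have cond : ∀ a b, G.dist a u = d → G.dist b u = d + 1 → D a = d ∧ d < D b := by
    intro a b h1 h2
    have := h.dist_eq a (by omega)
    have := hn b
    rcases h.dist_or b with h4 | h4 <;> omega
  have hAA : A ⊆ A' := fun w hw => (hA w).2 (.inl hw)
  have hOO : O ⊆ O' := fun w hw => (hO w).2 (.inl hw)
  constructor
  · intro w
    by_cases hw : w = b ∧ D a = d ∧ d < D b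
    · rw [(hD w).1 hw, hw.1]
      exact .inl (key hw.2.1 hw.2.2).2.symm
    · rw [(hD w).2 hw]
      exact h.dist_or w
  · intro w hwd
    rw [(hD w).2 ?_]
    · exact h.dist_eq w hwd
    · rintro ⟨rfl, h1, h2⟩
      have := (key h1 h2).2
      omega
  · intro w hw
    rcases (hA w).1 hw with hw | ⟨⟨rfl, h1, h2⟩, hnq, ha⟩
    · exact h.of_mem_avoid w hw
    · obtain ⟨h3, h4⟩ := key h1 h2
      exact (h.of_mem_avoid a ha).cons hab (by omega) (mt hq.2 hnq)
  · intro w hw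
    rcases (hO w).1 hw with hw | ⟨⟨rfl, h1, h2⟩, ⟨hq', ha⟩ | ⟨hnq, ha⟩⟩
    · exact h.of_mem_once w hw
    · obtain ⟨h3, h4⟩ := key h1 h2
      exact (h.of_mem_avoid a ha).cons_once hab (by omega) (hq.1 hq')
    · obtain ⟨h3, h4⟩ := key h1 h2
      exact (h.of_mem_once a ha).cons hab (by omega) (mt hq.2 hnq)
  · exact fun w hw hg => hAA (h.mem_avoid w hw hg)
  · exact fun w hw hg => hOO (h.mem_once w hw hg)
  · intro x y hxy hmem hx hy
    rcases hmem with heq | hmem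
    · obtain ⟨rfl, rfl⟩ := Prod.mk.inj heq
      have hc := cond x y hx hy
      refine ⟨(hD y).1 ⟨rfl, hc⟩, fun h1 h2 => ?_, fun h1 h2 => ?_, fun h1 h2 => ?_⟩
      · exact (hA y).2 (.inr ⟨⟨rfl, hc⟩, mt hq.1 h1, h.mem_avoid x hx.le h2⟩)
      · exact (hO y).2 (.inr ⟨⟨rfl, hc⟩, .inl ⟨hq.2 h1, h.mem_avoid x hx.le h2⟩⟩)
      · exact (hO y).2 (.inr ⟨⟨rfl, hc⟩, .inr ⟨mt hq.1 h1, h.mem_once x hx.le h2⟩⟩)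
    · obtain ⟨h0, h1, h2, h3⟩ := h.used x y hxy hmem hx hy
      refine ⟨?_, fun a b => hAA (h1 a b), fun a b => hOO (h2 a b), fun a b => hOO (h3 a b)⟩
      by_cases hw : y = b ∧ D a = d ∧ d < D b
      · exact (hD y).1 hw
      · rw [(hD y).2 hw, h0]

end SimpleGraph

/-! ### The program -/

namespace RAM

/-- `P ;; Q` is the program `P` followed by the program `Q`. -/
local infixr:60 " ;; " => Program.seq

-- Registers: the input, loop variables, operands, constants and the answer.
local notation "rN" => (0 : ℕ)
local notation "rM" => (1 : ℕ)
local notation "rTarget" => (3 : ℕ)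
local notation "rEdge" => (4 : ℕ)
local notation "rLevel" => (5 : ℕ)
local notation "rIndex" => (6 : ℕ)
local notation "rVertex" => (7 : ℕ)
local notation "rFst" => (8 : ℕ)
local notation "rSnd" => (9 : ℕ)
local notation "rColor" => (10 : ℕ)
local notation "rChosen" => (11 : ℕ)
local notation "rTmp" => (12 : ℕ)
local notation "rTmpTwo" => (13 : ℕ)
local notation "rOne" => (14 : ℕ)
local notation "rZero" => (15 : ℕ)
local notation "rAnswer" => (16 : ℕ)
local notation "rNext" => (17 : ℕ)
-- Arrays: the list of the edges, the record of a search, and the marks.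
local notation "aFst" => (0 : ℕ)
local notation "aSnd" => (1 : ℕ)
local notation "aColor" => (2 : ℕ)
local notation "aDist" => (3 : ℕ)
local notation "aAvoid" => (4 : ℕ)
local notation "aOnce" => (5 : ℕ)
local notation "aOk" => (6 : ℕ)

/-- Use the edge in hand, of colour `rColor`, from the vertex in register `p` to the vertex in
register `q`: if the first has distance `rLevel` and the second has no distance up to `rLevel`,
then the second gets the distance `rNext = rLevel + 1`, and shortest paths with no edge or one
edge of the colour `rChosen` are extended. -/
def relax (p q : ℕ) : Program :=
  .instr (.load rTmp aDist p) ;;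
  .ite (.eq rTmp rLevel)
    (.instr (.load rTmp aDist q) ;;
      .ite (.lt rLevel rTmp)
        (.instr (.store aDist q rNext) ;;
          .instr (.load rTmp aAvoid p) ;;
          .instr (.load rTmpTwo aOnce p) ;;
          .ite (.eq rColor rChosen)
            (.ite (.eq rTmp rOne) (.instr (.store aOnce q rOne)) .skip)
            (.ite (.eq rTmp rOne) (.instr (.store aAvoid q rOne)) .skip ;;
              .ite (.eq rTmpTwo rOne) (.instr (.store aOnce q rOne)) .skip))
        .skip)
    .skip

/-- Use the edge `rIndex` in both directions. -/
def relaxEdge : Program :=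
  .instr (.load rFst aFst rIndex) ;;
  .instr (.load rSnd aSnd rIndex) ;;
  .instr (.load rColor aColor rIndex) ;;
  relax rFst rSnd ;;
  relax rSnd rFst

/-- Use all edges, to pass from the distance `rLevel` to the next one. -/
def round : Program :=
  .instr (.succ rNext rLevel) ;;
  .forLoop rIndex rM relaxEdge

/-- The record before a search: the distance `n` stands for a distance not found. -/
def initSearch : Program :=
  .forLoop rVertex rN
    (.instr (.store aDist rVertex rN) ;;
      .instr (.store aAvoid rVertex rZero) ;;
      .instr (.store aOnce rVertex rZero)) ;;
  .instr (.store aDist rTarget rZero) ;;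
  .instr (.store aAvoid rTarget rOne)

/-- Find the vertices with a shortest path to `rTarget` that has no edge, or exactly one edge, of
the colour `rChosen`. -/
def search : Program :=
  initSearch ;;
  .forLoop rLevel rN round

/-- Mark the vertices with a shortest path found to have exactly one edge of the chosen colour. -/
def collect : Program :=
  .forLoop rVertex rN
    (.instr (.load rTmp aOnce rVertex) ;;
      .ite (.eq rTmp rOne) (.instr (.store aOk rVertex rOne)) .skip)

/-- Mark the target only. -/
def initMarks : Program :=
  .forLoop rVertex rN (.instr (.store aOk rVertex rZero)) ;;
  .instr (.store aOk rTarget rOne)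

/-- Search with the colour of the edge `rEdge`. -/
def searchColor : Program :=
  .instr (.load rChosen aColor rEdge) ;;
  search ;;
  collect

/-- Answer no if some vertex is not marked. -/
def checkMarks : Program :=
  .forLoop rVertex rN
    (.instr (.load rTmp aOk rVertex) ;;
      .ite (.eq rTmp rOne) .skip (.instr (.copy rAnswer rZero)))

/-- Answer no if some vertex has no conflict-free shortest path to `rTarget`. -/
def checkTarget : Program :=
  initMarks ;;
  .forLoop rEdge rM searchColor ;;
  checkMarks

/-- The program that decides strong conflict-free connectedness. -/
def decideSCFC : Program :=
  .instr (.const rOne 1) ;;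
  .instr (.const rZero 0) ;;
  .instr (.const rAnswer 1) ;;
  .forLoop rTarget rN checkTarget ;;
  .instr (.copy rN rAnswer)

/-! ### Correctness and running time of the program -/

open SimpleGraph

variable {V : Type*} {G : SimpleGraph V} {k : ℕ} {c : G.edgeSet → Fin k} {L : EdgeList G}

/-- The machine holds the input and the constants `1` and `0` in their registers. -/
structure HoldsInput (L : EdgeList G) (c : G.edgeSet → Fin k) (σ : State) : Prop where
  n : σ.reg rN = Nat.card V
  m : σ.reg rM = Nat.card G.edgeSet
  one : σ.reg rOne = 1
  zero : σ.reg rZero = 0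
  fst : ∀ j, σ.mem aFst (j : Fin (Nat.card G.edgeSet)) = L.vert (L.fst j)
  snd : ∀ j, σ.mem aSnd (j : Fin (Nat.card G.edgeSet)) = L.vert (L.snd j)
  color : ∀ j, σ.mem aColor (j : Fin (Nat.card G.edgeSet)) = (c (L.edge j) : ℕ) + 1

theorem HoldsInput.frame {P : Program} {σ τ : State} (h : HoldsInput L c σ) (hf : Frame P σ τ)
    (hP : (∀ x ∈ [rN, rM, rOne, rZero], x ∉ P.regs) ∧
      ∀ A ∈ [aFst, aSnd, aColor], A ∉ P.arrays) : HoldsInput L c τ where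
  n := (hf.1 _ (hP.1 _ (by simp))).trans h.n
  m := (hf.1 _ (hP.1 _ (by simp))).trans h.m
  one := (hf.1 _ (hP.1 _ (by simp))).trans h.one
  zero := (hf.1 _ (hP.1 _ (by simp))).trans h.zero
  fst j := by rw [hf.2 _ (hP.2 _ (by simp)), h.fst]
  snd j := by rw [hf.2 _ (hP.2 _ (by simp)), h.snd]
  color j := by rw [hf.2 _ (hP.2 _ (by simp)), h.color]

/-- The arrays satisfy the invariant of the search. -/
def HoldsSearch (L : EdgeList G) (c : G.edgeSet → Fin k) (i : Fin k) (u : V) (d : ℕ)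
    (E : Set (V × V)) (σ : State) : Prop :=
  SearchInv c i u d E (fun w => σ.mem aDist (L.vert w)) {w | σ.mem aAvoid (L.vert w) = 1}
    {w | σ.mem aOnce (L.vert w) = 1}

/-- The effect of `relax p q` on the arrays, in the form that `SearchInv.use` asks for. -/
theorem runs_relax_effect {p q : ℕ} (hp : p ≠ rTmp ∧ p ≠ rTmpTwo) (hq : q ≠ rTmp ∧ q ≠ rTmpTwo)
    (σ : State) (h1 : σ.reg rOne = 1) :
    Runs (relax p q) σ 12 fun τ => ∀ x,
      ((x = σ.reg q ∧ σ.mem aDist (σ.reg p) = σ.reg rLevel ∧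
          σ.reg rLevel < σ.mem aDist (σ.reg q) → τ.mem aDist x = σ.reg rNext) ∧
        (¬ (x = σ.reg q ∧ σ.mem aDist (σ.reg p) = σ.reg rLevel ∧
          σ.reg rLevel < σ.mem aDist (σ.reg q)) → τ.mem aDist x = σ.mem aDist x)) ∧
      (τ.mem aAvoid x = 1 ↔ σ.mem aAvoid x = 1 ∨
        (x = σ.reg q ∧ σ.mem aDist (σ.reg p) = σ.reg rLevel ∧
          σ.reg rLevel < σ.mem aDist (σ.reg q)) ∧
          ¬ σ.reg rColor = σ.reg rChosen ∧ σ.mem aAvoid (σ.reg p) = 1) ∧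
      (τ.mem aOnce x = 1 ↔ σ.mem aOnce x = 1 ∨
        (x = σ.reg q ∧ σ.mem aDist (σ.reg p) = σ.reg rLevel ∧
          σ.reg rLevel < σ.mem aDist (σ.reg q)) ∧
          (σ.reg rColor = σ.reg rChosen ∧ σ.mem aAvoid (σ.reg p) = 1 ∨
            ¬ σ.reg rColor = σ.reg rChosen ∧ σ.mem aOnce (σ.reg p) = 1)) := by
  obtain ⟨hp1, hp2⟩ := hp
  obtain ⟨hq1, hq2⟩ := hq
  refine Runs.instr_seq (Runs.ite (fun hd => Runs.instr_seq (Runs.ite (fun hlt => ?_)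
    fun hlt => ?_)) fun hd => ?_)
  · refine Runs.instr_seq (Runs.instr_seq (Runs.instr_seq (Runs.ite (fun hc => ?_) fun hc => ?_)))
    · refine Runs.ite (fun ha => Runs.instr ?_) fun ha => Runs.skip ?_ <;>
        simp [Test.Holds, Instr.apply, hp1, hp2, hq1, hq2, h1] at * <;> grind
    · refine Runs.ite_seq (fun ha => Runs.instr_seq ?_) fun ha => Runs.skip_seq ?_ <;>
        refine Runs.ite (fun ho => Runs.instr ?_) fun ho => Runs.skip ?_ <;>
        simp [Test.Holds, Instr.apply, hp1, hp2, hq1, hq2, h1] at * <;> grind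
  · refine Runs.skip ?_
    simp [Test.Holds, Instr.apply, hp1, hp2, hq1, hq2, h1] at *
    grind
  · refine Runs.skip ?_
    simp [Test.Holds, Instr.apply, hp1, hp2, hq1, hq2, h1] at *
    grind
theorem runs_relax (hG : G.Connected) [Finite V] {p q : ℕ} (hp : p ≠ rTmp ∧ p ≠ rTmpTwo)
    (hq : q ≠ rTmp ∧ q ≠ rTmpTwo) {σ : State} {i : Fin k} {u a b : V} {d : ℕ} {E : Set (V × V)}
    (h1 : σ.reg rOne = 1) (hlev : σ.reg rLevel = d) (hnext : σ.reg rNext = d + 1)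
    (hpa : σ.reg p = L.vert a) (hqb : σ.reg q = L.vert b) (hab : G.Adj b a)
    (hc : σ.reg rColor = σ.reg rChosen ↔ c ⟨s(b, a), hab⟩ = i)
    (h : HoldsSearch L c i u d E σ) :
    Runs (relax p q) σ 12 (HoldsSearch L c i u d (insert (a, b) E)) := by
  have hv : ∀ w, ((L.vert w : ℕ) = L.vert b ↔ w = b) := fun w => by
    rw [Fin.val_inj, L.vert.apply_eq_iff_eq]
  refine (runs_relax_effect hp hq σ h1).mono le_rfl fun τ hτ => ?_
  simp only [hpa, hqb, hlev, hnext] at hτ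
  refine h.use hG hab hc (fun w => ?_) (fun w => ?_) fun w => ?_
  · have := (hτ (L.vert w)).1
    rwa [hv] at this
  · have := (hτ (L.vert w)).2.1
    rwa [hv] at this
  · have := (hτ (L.vert w)).2.2
    rwa [hv] at this

/-- The pairs of vertices joined by one of the first `j` edges. -/
def edgePairs (L : EdgeList G) (j : ℕ) : Set (V × V) :=
  {x | ∃ l : Fin (Nat.card G.edgeSet), (l : ℕ) < j ∧ (L.edge l : Sym2 V) = s(x.1, x.2)}

theorem edgePairs_succ_subset (j : Fin (Nat.card G.edgeSet)) :
    edgePairs L (j + 1) ⊆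
      insert (L.snd j, L.fst j) (insert (L.fst j, L.snd j) (edgePairs L j)) := by
  rintro ⟨a, b⟩ ⟨l, hl, he⟩
  rcases Nat.lt_succ_iff_lt_or_eq.1 hl with h | h
  · exact .inr (.inr ⟨l, h, he⟩)
  · obtain rfl : l = j := Fin.ext h
    rw [L.edge_eq, Sym2.eq_iff] at he
    rcases he with ⟨h1, h2⟩ | ⟨h1, h2⟩ <;> simp [h1, h2]

theorem mem_edgePairs_of_adj {a b : V} (h : G.Adj b a) :
    (a, b) ∈ edgePairs L (Nat.card G.edgeSet) :=
  ⟨L.edge.symm ⟨s(a, b), h.symm⟩, Fin.is_lt _, by rw [Equiv.apply_symm_apply]⟩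

theorem runs_relaxEdge [Finite V] (hG : G.Connected) {σ : State} {i : Fin k} {u : V} {d : ℕ}
    (j : Fin (Nat.card G.edgeSet)) (hin : HoldsInput L c σ) (hlev : σ.reg rLevel = d)
    (hnext : σ.reg rNext = d + 1) (hi : σ.reg rChosen = i + 1) (hj : σ.reg rIndex = j)
    (h : HoldsSearch L c i u d (edgePairs L j) σ) :
    Runs relaxEdge σ 27 (HoldsSearch L c i u d (edgePairs L (j + 1))) := by
  have hmem : s(L.fst j, L.snd j) ∈ G.edgeSet := by
    rw [← L.edge_eq j]
    exact (L.edge j).2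
  have hadj : G.Adj (L.fst j) (L.snd j) := hmem
  have he : L.edge j = ⟨s(L.fst j, L.snd j), hmem⟩ := Subtype.ext (L.edge_eq j)
  have he' : L.edge j = ⟨s(L.snd j, L.fst j), hadj.symm⟩ :=
    Subtype.ext ((L.edge_eq j).trans Sym2.eq_swap)
  refine Runs.instr_seq (Runs.instr_seq (Runs.instr_seq (Runs.seq (S := 12) (T := 12)
    (Runs.frame (runs_relax hG (L := L) (c := c) (i := i) (u := u) (d := d) (a := L.fst j)
      (b := L.snd j) (E := edgePairs L j) (by simp) (by simp) ?_ ?_ ?_ ?_ ?_ hadj.symm ?_ ?_))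
    ?_)))
  · simpa [Instr.apply] using hin.one
  · simpa [Instr.apply] using hlev
  · simpa [Instr.apply] using hnext
  · simpa [Instr.apply, hj] using hin.fst j
  · simpa [Instr.apply, hj] using hin.snd j
  · rw [← he']
    simp [Instr.apply, hj, hi, hin.color j, Fin.val_inj]
  · simpa [Instr.apply, HoldsSearch] using h
  · rintro τ ⟨hf, hτ⟩
    have hreg : ∀ x, x ∉ (relax rFst rSnd).regs → τ.reg x = _ := hf.1
    refine (runs_relax hG (L := L) (a := L.snd j) (b := L.fst j) (by simp) (by simp)
      ?_ ?_ ?_ ?_ ?_ hadj ?_ hτ).mono le_rfl fun υ hυ => hυ.anti (edgePairs_succ_subset j)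
    · rw [hreg _ (by decide)]
      simpa [Instr.apply] using hin.one
    · rw [hreg _ (by decide)]
      simpa [Instr.apply] using hlev
    · rw [hreg _ (by decide)]
      simpa [Instr.apply] using hnext
    · rw [hreg _ (by decide)]
      simpa [Instr.apply, hj] using hin.snd j
    · rw [hreg _ (by decide)]
      simpa [Instr.apply, hj] using hin.fst j
    · rw [hreg _ (by decide), hreg _ (by decide), ← he]
      simp [Instr.apply, hj, hi, hin.color j, Fin.val_inj]

theorem runs_round [Finite V] (hG : G.Connected) {σ : State} {i : Fin k} {u : V} {d : ℕ}
    (hin : HoldsInput L c σ) (hlev : σ.reg rLevel = d) (hi : σ.reg rChosen = i + 1)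
    (h : HoldsSearch L c i u d ∅ σ) :
    Runs round σ (Nat.card G.edgeSet * 29 + 3) (HoldsSearch L c i u (d + 1) ∅) := by
  refine Runs.instr_seq ((Runs.forLoop (T := 27)
    (fun j τ => HoldsSearch L c i u d (edgePairs L j) τ) (N := Nat.card G.edgeSet)
    (by simpa [Instr.apply] using hin.m) (by decide) (by decide) ?_ ?_).mono le_rfl
      fun τ hτ => hτ.2.next hG fun a b hab => mem_edgePairs_of_adj hab)
  · refine SearchInv.anti (E := ∅) h ?_
    rintro x ⟨l, hl, -⟩
    omega
  · intro j hj τ hf hx hτ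
    refine runs_relaxEdge hG ⟨j, hj⟩ ?_ ?_ ?_ ?_ hx hτ
    · refine HoldsInput.frame (P := round) hin ?_ (by decide)
      refine Frame.trans ?_ (hf.mono (by simp [round, Program.regs])
        (by simp [round, Program.arrays]))
      exact (Frame.of_exec (.instr _ _)).mono (by simp [round, Program.regs])
        (by simp [round, Program.arrays])
    · rw [hf.1 _ (by decide)]
      simpa [Instr.apply] using hlev
    · rw [hf.1 _ (by decide)]
      simp [Instr.apply, hlev]
    · rw [hf.1 _ (by decide)]
      simpa [Instr.apply] using hi

theorem runs_initSearch [Finite V] (hG : G.Connected) {σ : State} {i : Fin k} {u : V}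
    (hin : HoldsInput L c σ) (hu : σ.reg rTarget = L.vert u) :
    Runs initSearch σ (Nat.card V * 5 + 4) (HoldsSearch L c i u 0 ∅) := by
  refine Runs.seq (S := Nat.card V * 5 + 2) (T := 2) (Runs.forLoop (T := 3) (N := Nat.card V)
    (fun j τ => ∀ x < j, τ.mem aDist x = Nat.card V ∧ τ.mem aAvoid x = 0 ∧ τ.mem aOnce x = 0)
    hin.n (by decide) (by decide) (by simp) ?_) ?_
  · intro j hj τ hf hx hτ
    refine Runs.instr_seq (Runs.instr_seq (Runs.instr fun x hxj => ?_))
    have h0 : τ.reg rN = Nat.card V := (hf.1 _ (by decide)).trans hin.n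
    have h1 : τ.reg rZero = 0 := (hf.1 _ (by decide)).trans hin.zero
    by_cases hxj' : x = j
    · simp [Instr.apply, hx, hxj', h0, h1]
    · simpa [Instr.apply, hx, hxj'] using hτ x (by omega)
  · rintro τ ⟨hf, hτ⟩
    refine Runs.instr_seq (Runs.instr ?_)
    have h1 : τ.reg rOne = 1 := (hf.1 _ (by decide)).trans hin.one
    have h0 : τ.reg rZero = 0 := (hf.1 _ (by decide)).trans hin.zero
    have h3 : τ.reg rTarget = L.vert u := (hf.1 _ (by decide)).trans hu
    have hv : ∀ w, ((L.vert w : ℕ) = L.vert u ↔ w = u) := fun w => by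
      rw [Fin.val_inj, L.vert.apply_eq_iff_eq]
    refine SearchInv.init hG ?_ (fun w hw => ?_) (fun w => ?_) fun w => ?_
    · simp [Instr.apply, h0, h3]
    · simpa [Instr.apply, h3, hv, hw] using (hτ _ (L.vert w).2).1
    · simp [Instr.apply, h1, h3, hv, (hτ _ (L.vert w).2).2.1]
    · simp [Instr.apply, (hτ _ (L.vert w).2).2.2]

theorem runs_search [Finite V] (hG : G.Connected) {σ : State} {i : Fin k} {u : V}
    (hin : HoldsInput L c σ) (hu : σ.reg rTarget = L.vert u) (hi : σ.reg rChosen = i + 1) :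
    Runs search σ (Nat.card V * 5 + 4 + (Nat.card V * (Nat.card G.edgeSet * 29 + 5) + 2))
      fun τ => ∀ w, τ.mem aOnce (L.vert w) = 1 ↔ HasOnceGeodesic c i u w := by
  refine Runs.seq (Runs.frame (runs_initSearch (i := i) hG hin hu)) ?_
  rintro τ ⟨hf, hτ⟩
  have hin' := hin.frame hf (by decide)
  refine (Runs.forLoop (T := Nat.card G.edgeSet * 29 + 3)
    (fun d υ => HoldsSearch L c i u d ∅ υ) hin'.n (by decide) (by decide) hτ ?_).mono le_rfl ?_
  · intro d hd υ hf' hx hυ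
    refine runs_round hG (hin'.frame hf' (by decide)) hx ?_ hυ
    rw [hf'.1 _ (by decide), hf.1 _ (by decide), hi]
  · rintro υ ⟨-, hυ⟩ w
    exact ⟨hυ.of_mem_once w, hυ.mem_once w (hG.dist_lt_natCard u w).le⟩

theorem runs_collect {σ : State} (hin : HoldsInput L c σ) :
    Runs collect σ (Nat.card V * 5 + 2) fun τ => ∀ w : V, τ.mem aOk (L.vert w) = 1 ↔
      σ.mem aOk (L.vert w) = 1 ∨ σ.mem aOnce (L.vert w) = 1 := by
  refine (Runs.forLoop (T := 3) (fun j τ => ∀ x, τ.mem aOk x = 1 ↔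
    σ.mem aOk x = 1 ∨ (x < j ∧ σ.mem aOnce x = 1)) hin.n (by decide) (by decide)
    (by simp) ?_).mono le_rfl ?_
  · intro j hj τ hf hx hτ
    have h1 : τ.reg rOne = 1 := (hf.1 _ (by decide)).trans hin.one
    have h2 : τ.mem aOnce = σ.mem aOnce := hf.2 _ (by decide)
    refine Runs.instr_seq (Runs.ite (fun hb => Runs.instr fun x => ?_)
      fun hb => Runs.skip fun x => ?_) <;>
    · simp only [Test.Holds, Instr.apply, State.setReg_reg, hx, h1, h2] at hb
      have := hτ x
      simp only [Instr.apply, State.setReg_mem, State.setMem_mem, State.setReg_reg, hx, h1]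
      grind
  · rintro τ ⟨-, hτ⟩ w
    simp [hτ]

theorem runs_initMarks {σ : State} {u : V} (hin : HoldsInput L c σ)
    (hu : σ.reg rTarget = L.vert u) :
    Runs initMarks σ (Nat.card V * 3 + 3) fun τ =>
      ∀ w : V, τ.mem aOk (L.vert w) = 1 ↔ w = u := by
  refine Runs.seq (S := Nat.card V * 3 + 2) (T := 1) (Runs.forLoop (T := 1) (N := Nat.card V)
    (fun j τ => ∀ x < j, τ.mem aOk x = 0) hin.n (by decide) (by decide) (by simp) ?_) ?_
  · intro j hj τ hf hx hτ
    refine Runs.instr fun x hxj => ?_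
    have h1 : τ.reg rZero = 0 := (hf.1 _ (by decide)).trans hin.zero
    by_cases hxj' : x = j
    · simp [Instr.apply, hx, hxj', h1]
    · simpa [Instr.apply, hx, hxj'] using hτ x (by omega)
  · rintro τ ⟨hf, hτ⟩
    refine Runs.instr fun w => ?_
    have h1 : τ.reg rOne = 1 := (hf.1 _ (by decide)).trans hin.one
    have h3 : τ.reg rTarget = L.vert u := (hf.1 _ (by decide)).trans hu
    have hv : ((L.vert w : ℕ) = L.vert u ↔ w = u) := by
      rw [Fin.val_inj, L.vert.apply_eq_iff_eq]
    simp [Instr.apply, h1, h3, hv, hτ _ (L.vert w).2]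

theorem runs_searchColor [Finite V] (hG : G.Connected) {σ : State} {u : V}
    (hin : HoldsInput L c σ) (hu : σ.reg rTarget = L.vert u) (j : Fin (Nat.card G.edgeSet))
    (hj : σ.reg rEdge = j) :
    Runs searchColor σ (Nat.card V * Nat.card G.edgeSet * 29 + Nat.card V * 15 + 9) fun τ =>
      ∀ w : V, τ.mem aOk (L.vert w) = 1 ↔
        σ.mem aOk (L.vert w) = 1 ∨ HasOnceGeodesic c (c (L.edge j)) u w := by
  have hf₀ : Frame searchColor σ ((Instr.load rChosen aColor rEdge).apply σ) :=
    (Frame.of_exec (.instr _ _)).mono (by simp [searchColor, Program.regs])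
      (by simp [searchColor, Program.arrays])
  have hin₀ := hin.frame hf₀ (by decide)
  refine Runs.mono (Runs.instr_seq (Runs.seq (T := Nat.card V * 5 + 2)
    (Runs.frame (runs_search (i := c (L.edge j)) (u := u) hG hin₀ (by simpa [Instr.apply] using hu) ?_)) (R := _) ?_)) ?_ fun _ h => h
  · simpa [Instr.apply, hj] using hin.color j
  · rintro τ ⟨hf, hτ⟩
    refine (runs_collect (hin₀.frame hf (by decide))).mono le_rfl fun υ hυ w => ?_
    rw [hυ, hτ, hf.2 _ (by decide)]
    rfl
  · ring_nf
    omega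

/-- The answer register says `1` if `p` is true and `0` if not. -/
def Answers (σ : State) (p : Prop) : Prop :=
  (p → σ.reg rAnswer = 1) ∧ (¬ p → σ.reg rAnswer = 0)

theorem Answers.congr {σ τ : State} {p q : Prop} (h : Answers σ p)
    (hr : τ.reg rAnswer = σ.reg rAnswer) (hpq : p ↔ q) : Answers τ q := by
  rwa [Answers, hr, ← hpq]

theorem runs_checkMarks {σ : State} (hin : HoldsInput L c σ) {p : Prop} (hp : Answers σ p) :
    Runs checkMarks σ (Nat.card V * 5 + 2) fun τ =>
      Answers τ (p ∧ ∀ w : V, σ.mem aOk (L.vert w) = 1) := by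
  refine (Runs.forLoop (T := 3) (fun j τ => Answers τ (p ∧ ∀ x < j, σ.mem aOk x = 1)) hin.n
    (by decide) (by decide) (hp.congr (by simp) (by simp)) ?_).mono le_rfl ?_
  · intro j hj τ hf hx hτ
    have h0 : τ.reg rZero = 0 := (hf.1 _ (by decide)).trans hin.zero
    have h1 : τ.reg rOne = 1 := (hf.1 _ (by decide)).trans hin.one
    have h2 : τ.mem aOk = σ.mem aOk := hf.2 _ (by decide)
    refine Runs.instr_seq (Runs.ite (fun hb => Runs.skip ?_) fun hb => Runs.instr ?_)
    · simp only [Test.Holds, Instr.apply, State.setReg_reg, hx, h1, h2] at hb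
      refine hτ.congr (by simp [Instr.apply]) (and_congr_right fun _ => ?_)
      rw [Nat.forall_lt_succ_right]
      exact (and_iff_left hb).symm
    · simp only [Test.Holds, Instr.apply, State.setReg_reg, hx, h1, h2] at hb
      exact ⟨fun h => absurd (h.2 j (by omega)) hb, fun _ => by simp [Instr.apply, h0]⟩
  · rintro τ ⟨-, hτ⟩
    refine hτ.congr rfl (and_congr_right fun _ => ⟨fun h w => h _ (L.vert w).2, fun h x hx => ?_⟩)
    simpa using h (L.vert.symm ⟨x, hx⟩)

theorem runs_checkTarget [Finite V] (hG : G.Connected) {σ : State} {u : V} {p : Prop}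
    (hin : HoldsInput L c σ) (hu : σ.reg rTarget = L.vert u) (hp : Answers σ p) :
    Runs checkTarget σ (Nat.card V * 3 + 3 + (Nat.card G.edgeSet *
        (Nat.card V * Nat.card G.edgeSet * 29 + Nat.card V * 15 + 9 + 2) + 2 +
          (Nat.card V * 5 + 2))) fun τ =>
      Answers τ (p ∧ ∀ w : V, w = u ∨ ∃ i, HasOnceGeodesic c i u w) := by
  refine Runs.seq (runs_initMarks hin hu).frame ?_
  rintro τ ⟨hf, hτ⟩
  have hin' := hin.frame hf (by decide)
  refine Runs.seq (Runs.forLoop (N := Nat.card G.edgeSet) (fun j υ => ∀ w : V,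
    υ.mem aOk (L.vert w) = 1 ↔ w = u ∨ ∃ l : Fin (Nat.card G.edgeSet), (l : ℕ) < j ∧
      HasOnceGeodesic c (c (L.edge l)) u w) hin'.m (by decide) (by decide)
      (by simpa using hτ) fun j hj υ hf' hx hυ => ?_) ?_
  · refine (runs_searchColor (u := u) hG (hin'.frame hf' (by decide)) ?_ ⟨j, hj⟩ hx).mono le_rfl
      fun ρ hρ w => ?_
    · rw [hf'.1 _ (by decide), hf.1 _ (by decide), hu]
    · rw [State.setReg_mem, hρ, hυ, or_assoc]
      refine or_congr_right ⟨?_, ?_⟩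
      · rintro (⟨l, hl, h⟩ | h)
        · exact ⟨l, by omega, h⟩
        · exact ⟨⟨j, hj⟩, Nat.lt_succ_self j, h⟩
      · rintro ⟨l, hl, h⟩
        rcases Nat.lt_succ_iff_lt_or_eq.1 hl with hl | rfl
        · exact .inl ⟨l, hl, h⟩
        · exact .inr h
  · rintro υ ⟨hf', hυ⟩
    refine (runs_checkMarks (hin'.frame hf' (by decide)) (p := p) (hp.congr ?_ Iff.rfl)).mono
      le_rfl fun ρ hρ => hρ.congr rfl (and_congr_right fun _ => forall_congr' fun w => ?_)
    · rw [hf'.1 _ (by decide), hf.1 _ (by decide)]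
    · rw [hυ]
      refine or_congr_right ⟨fun ⟨l, _, h⟩ => ⟨_, h⟩, fun ⟨i, h⟩ => ?_⟩
      -- a colour that occurs once on a path is the colour of some edge of the list
      obtain ⟨e, rfl⟩ := h.exists_color_eq
      exact ⟨L.edge.symm e, Fin.is_lt _, by rwa [Equiv.apply_symm_apply]⟩

theorem holdsInput_initialState :
    HoldsInput L c ((((L.initialState c).setReg rOne 1).setReg rZero 0).setReg rAnswer 1) where
  n := rfl
  m := rfl
  one := rfl
  zero := rfl
  fst j := dif_pos j.2
  snd j := dif_pos j.2
  color j := dif_pos j.2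

/-- A connected graph with at least two vertices has an edge, so all terms of the running time
are dominated by the leading one. -/
theorem runningTime_le [Finite V] (hG : G.Connected) :
    Nat.card V * (Nat.card V * 3 + 3 + (Nat.card G.edgeSet *
        (Nat.card V * Nat.card G.edgeSet * 29 + Nat.card V * 15 + 9 + 2) + 2 +
          (Nat.card V * 5 + 2)) + 2) + 2 + 1 + 1 + 1 + 1 ≤
      78 * ((Nat.card V) ^ 2 * (Nat.card G.edgeSet) ^ 2 + 1) := by
  have hm : 1 < Nat.card V → 0 < Nat.card G.edgeSet := by
    intro h
    have := Finite.one_lt_card_iff_nontrivial.1 h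
    obtain ⟨v⟩ := hG.nonempty
    obtain ⟨w, hw⟩ := hG.preconnected.exists_adj_of_nontrivial v
    have : Nonempty G.edgeSet := ⟨⟨s(v, w), hw⟩⟩
    exact Nat.card_pos
  generalize Nat.card V = n at *
  generalize Nat.card G.edgeSet = m at *
  rcases Nat.eq_zero_or_pos m with rfl | hm0
  · have : n ≤ 1 := by
      by_contra h
      exact absurd (hm (by omega)) (lt_irrefl 0)
    interval_cases n <;> norm_num
  · have h1 : n ≤ n ^ 2 := Nat.le_self_pow two_ne_zero n
    have h2 : m ≤ m ^ 2 := Nat.le_self_pow two_ne_zero m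
    have h3 : n ^ 2 * 1 ≤ n ^ 2 * m ^ 2 := Nat.mul_le_mul_left _ (by omega)
    have h4 : n ^ 2 * m ≤ n ^ 2 * m ^ 2 := Nat.mul_le_mul_left _ h2
    have h5 : n * m ≤ n ^ 2 * m ^ 2 := Nat.mul_le_mul h1 h2
    linarith

theorem runs_decideSCFC [Finite V] (hG : G.Connected) :
    Runs decideSCFC (L.initialState c)
      (78 * ((Nat.card V) ^ 2 * (Nat.card G.edgeSet) ^ 2 + 1)) fun τ =>
        (G.StronglyConflictFreeConnected c → τ.reg rN = 1) ∧
          (¬ G.StronglyConflictFreeConnected c → τ.reg rN = 0) := by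
  have hin := holdsInput_initialState (L := L) (c := c)
  refine Runs.mono (Runs.instr_seq (Runs.instr_seq (Runs.instr_seq (Runs.seq
    (T := 1) (Runs.forLoop (N := Nat.card V) (fun j τ => Answers τ (∀ u : V, (L.vert u : ℕ) < j →
      ∀ w : V, w = u ∨ ∃ i, HasOnceGeodesic c i u w)) hin.n (by decide) (by decide) ?_
      fun j hj τ hf hx hτ => ?_) fun τ hτ => ?_)))) (runningTime_le hG) fun _ h => h
  · simp [Answers, Instr.apply]
  · have hu : τ.reg rTarget = L.vert (L.vert.symm ⟨j, hj⟩) := by simpa using hx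
    refine (runs_checkTarget hG (hin.frame hf (by decide)) hu hτ).mono le_rfl fun υ hυ =>
      hυ.congr (by simp) ⟨fun h u hl => ?_, fun h => ⟨fun u hl => h u (by omega), ?_⟩⟩
    · rcases Nat.lt_succ_iff_lt_or_eq.1 hl with hl | rfl
      · exact h.1 u hl
      · simpa using h.2
    · exact h _ (by simp)
  · refine Runs.instr (T := 0) ?_
    rw [stronglyConflictFreeConnected_iff]
    simpa [Answers, Instr.apply] using hτ.2

end RAM

theorem mainTheorem5 :
    ∃ (P : RAM.Program) (C : ℕ),
      ∀ (V : Type*) [Finite V] (G : SimpleGraph V) (_ : G.Connected) (k : ℕ) (_ : 1 ≤ k)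
        (c : G.edgeSet → Fin k) (L : EdgeList G),
        ∃ (σ : RAM.State) (t : ℕ),
          RAM.Exec P (L.initialState c) σ t ∧
          t ≤ C * ((Nat.card V) ^ 2 * (Nat.card G.edgeSet) ^ 2 + 1) ∧
          (G.StronglyConflictFreeConnected c → σ.reg 0 = 1) ∧
          (¬ G.StronglyConflictFreeConnected c → σ.reg 0 = 0) := by
  refine ⟨RAM.decideSCFC, 78, fun V _ G hG k _ c L => ?_⟩
  obtain ⟨σ, t, he, ht, h⟩ := RAM.runs_decideSCFC hG (c := c) (L := L)
  exact ⟨σ, t, he, ht, h⟩
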